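/- Let $1\le s\le k$ be integers and let $D\subseteq\mathbb{R}^m$ be open. Let $H:D\to\mathbb{R}$ be of class $C^{2k+1}$ (not necessarily a polynomial), and let $B:D\to\mathbb{R}^{m\times m}$ be of class $C^{2k}$ with $B(y)^\top=-B(y)$ for all $y\in D$. Let $y_0\in D$, and consider the Poisson problem $\dot y=B(y)\nabla H(y)$, $y(0)=y_0$. Let $\{P_j\}_{j\ge0}$ be the Legendre polynomials orthonormal on $[0,1]$ (so $\deg P_j=j$, $\int_0^1P_iP_j\,dx=\delta_{ij}$, with positive leading coefficients), and let $(c_\ell,b_\ell)_{\ell=1}^k$ be the abscissae and weights of the Gauss–Legendre formula of order $2k$ on $[0,1]$, i.e. the interpolatory quadrature formula based at the zeros of $P_k$. For a time-step $h>0$, a step of the method PHBVM$(k,s)$ is given by a polynomial path $u:[0,h]\to\mathbb{R}^m$ such that $$u(ch)=y_0+h\sum_{i,j=0}^{s-1}\int_0^cP_i(x)\,dx\;\hat\rho_{ij}(u)\,\hat\gamma_j(u),\qquad c\in[0,1],$$ $$\hat\gamma_j(u)=\sum_{\ell=1}^kb_\ell P_j(c_\ell)\nabla H(u(c_\ell h)),\qquad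 \hat\rho_{ij}(u)=\sum_{\ell=1}^kb_\ell P_i(c_\ell)P_j(c_\ell)B(u(c_\ell h)),$$ and the new approximation is $y_1:=u(h)$. Then $H(y_1)=H(y_0)+O(h^{2k+1})$ as $h\to0^+$. Precisely: for every compact set $K\subseteq D$ with $y_0$ in its interior there are $h_0>0$ and a constant $C$ such that, for every $0<h\le h_0$, the method has a solution $u$ whose stages $u(c_1h),\dots,u(c_kh)$ all lie in $K$, and every such solution $u$ satisfies $y_1=u(h)\in D$ and $$|H(y_1)-H(y_0)|\le C\,h^{2k+1}.$$ -/

import Mathlib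

namespace PHBVM

noncomputable section

/-- The `j`-th Legendre polynomial orthonormal on `[0, 1]`, with positive leading coefficient:
`deg P_j = j` and `∫ x in 0..1, P_i x * P_j x = δ_ij`. The integer polynomial
`Polynomial.shiftedLegendre j` is `(-1) ^ j` times the classical shifted one. -/
def legendre (j : ℕ) : Polynomial ℝ :=
  Polynomial.C ((-1) ^ j * Real.sqrt (2 * j + 1)) *
    (Polynomial.shiftedLegendre j).map (Int.castRingHom ℝ)

/-- The abscissae of the Gauss-Legendre formula of order `2 k`: the zeros of `P_k`. -/
def gaussNodes (k : ℕ) : Finset ℝ := (legendre k).roots.toFinset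

/-- The weight of the interpolatory quadrature formula on `[0, 1]` with abscissae `gaussNodes k`
that belongs to the abscissa `c`. -/
def gaussWeight (k : ℕ) (c : ℝ) : ℝ :=
  ∫ x in (0 : ℝ)..1, (Lagrange.basis (gaussNodes k) id c).eval x

variable {m : ℕ}

/-- The approximate Fourier coefficient `γ̂_j(u) = ∑_ℓ b_ℓ P_j(c_ℓ) ∇H(u(c_ℓ h))`. -/
def gammaHat (k : ℕ) (H : EuclideanSpace ℝ (Fin m) → ℝ) (h : ℝ)
    (u : ℝ → EuclideanSpace ℝ (Fin m)) (j : ℕ) : EuclideanSpace ℝ (Fin m) :=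
  ∑ c ∈ gaussNodes k, (gaussWeight k c * (legendre j).eval c) • gradient H (u (c * h))

/-- The approximate Fourier coefficient `ρ̂_ij(u) = ∑_ℓ b_ℓ P_i(c_ℓ) P_j(c_ℓ) B(u(c_ℓ h))`. -/
def rhoHat (k : ℕ) (B : EuclideanSpace ℝ (Fin m) → Matrix (Fin m) (Fin m) ℝ) (h : ℝ)
    (u : ℝ → EuclideanSpace ℝ (Fin m)) (i j : ℕ) : Matrix (Fin m) (Fin m) ℝ :=
  ∑ c ∈ gaussNodes k,
    (gaussWeight k c * (legendre i).eval c * (legendre j).eval c) • B (u (c * h))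

/-- `u` (on `[0, h]`) is a polynomial path produced by one step of length `h`, started at `y₀`, of
the PHBVM(k, s) method for the Poisson problem `y' = B(y) ∇H(y)`. The new approximation is
`y₁ = u h`. The equation determines `u` through its values at the points `c_ℓ h` only. -/
def IsPath (k s : ℕ) (B : EuclideanSpace ℝ (Fin m) → Matrix (Fin m) (Fin m) ℝ)
    (H : EuclideanSpace ℝ (Fin m) → ℝ) (h : ℝ) (y₀ : EuclideanSpace ℝ (Fin m))
    (u : ℝ → EuclideanSpace ℝ (Fin m)) : Prop :=
  ∀ c ∈ Set.Icc (0 : ℝ) 1,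
    u (c * h) = y₀ + h • ∑ i ∈ Finset.range s, ∑ j ∈ Finset.range s,
      (∫ x in (0 : ℝ)..c, (legendre i).eval x) •
        Matrix.toEuclideanLin (rhoHat k B h u i j) (gammaHat k H h u j)

end

end PHBVM

namespace PHBVM

open Polynomial intervalIntegral

/-! Rescale the path to v(c) = u(ch) on [0, 1]. Then v' = h ∑ P_i a_i over i < s, with a_i = ∑_j
ρ̂_ij γ̂_j, and the chain rule gives H(y₁) - H(y₀) = h ∑ ⟨γ_i, a_i⟩, where γ_i = ∫ P_i ∇H(v) is the
exact Fourier coefficient (`hamiltonian_sub_eq`). With γ̂_i in place of γ_i the sum vanishes,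
because ρ̂ is symmetric in its indices and has skew entries (`sum_inner_gammaHat_stageCoeff`). So
the energy error is h ∑ ⟨γ_i - γ̂_i, a_i⟩. Gauss quadrature is exact below degree 2k, hence γ_i -
γ̂_i = O(h^(2k-i)), while orthogonality gives a_i = O(h^i). Each term is O(h^(2k)), and the
prefactor supplies the last power (`exists_energy_bound`).

Both estimates need the q-th derivative of v to be O(h^q), so that a smooth function along v is a
polynomial of degree below n up to O(h^n). Those derivatives are in turn controlled by the a_i. The
circle is broken by induction on the order (`exists_isSlowCurve_of_fixed`). Existence of a step is a
contraction argument in the stages (`exists_isPath`). -/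

theorem intervalIntegrable_eval (p : ℝ[X]) (a b : ℝ) :
    IntervalIntegrable (fun x => p.eval x) MeasureTheory.volume a b :=
  p.continuous.intervalIntegrable a b

theorem integral_eval_derivative (p : ℝ[X]) (a b : ℝ) :
    ∫ x in a..b, (derivative p).eval x = p.eval b - p.eval a :=
  integral_eq_sub_of_hasDerivAt (fun x _ => p.hasDerivAt x)
    (intervalIntegrable_eval _ a b)

theorem exists_antiderivative (p : ℝ[X]) :
    ∃ q : ℝ[X], derivative q = p ∧ q.eval 0 = 0 := by
  refine ⟨∑ n ∈ Finset.range (p.natDegree + 1), monomial (n + 1) (p.coeff n / (n + 1)), ?_, ?_⟩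
  · conv_rhs => rw [p.as_sum_range]
    rw [derivative_sum]
    refine Finset.sum_congr rfl fun n _ => ?_
    rw [derivative_monomial]
    have : (n : ℝ) + 1 ≠ 0 := by positivity
    simp [div_mul_cancel₀ _ this]
  · simp [eval_finsetSum]

/-- The antiderivative of a polynomial that vanishes at the origin. -/
noncomputable def antiderivative (p : ℝ[X]) : ℝ[X] := (exists_antiderivative p).choose

theorem derivative_antiderivative (p : ℝ[X]) : derivative (antiderivative p) = p :=
  (exists_antiderivative p).choose_spec.1

theorem eval_zero_antiderivative (p : ℝ[X]) : (antiderivative p).eval 0 = 0 :=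
  (exists_antiderivative p).choose_spec.2

theorem integral_eval_eq (p : ℝ[X]) (c : ℝ) :
    ∫ x in (0 : ℝ)..c, p.eval x = (antiderivative p).eval c := by
  conv_lhs => rw [← derivative_antiderivative p]
  rw [integral_eval_derivative, eval_zero_antiderivative, sub_zero]

/-! ### Orthogonality -/

/-- Integration by parts: the boundary terms vanish, and each derivative moved from w to q lowers
the degree of q until q is zero. -/
theorem integral_iterate_derivative_mul_eq_zero {w : ℝ[X]} {n : ℕ}
    (h0 : ∀ i < n, (derivative^[i] w).eval 0 = 0) (h1 : ∀ i < n, (derivative^[i] w).eval 1 = 0) :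
    ∀ i ≤ n, ∀ q : ℝ[X], q.degree < i →
      ∫ x in (0 : ℝ)..1, (derivative^[i] w * q).eval x = 0 := by
  intro i
  induction i with
  | zero =>
    intro _ q hq
    have : q = 0 := by
      rw [← degree_eq_bot]
      simpa [Nat.WithBot.lt_zero_iff] using hq
    simp [this]
  | succ i ih =>
    intro hi q hq
    have e : derivative^[i + 1] w * q
        = derivative (derivative^[i] w * q) - derivative^[i] w * derivative q := by
      rw [Function.iterate_succ_apply', derivative_mul]; ring
    have hq' : (derivative q).degree < i := by
      by_cases h : q = 0
      · simp [h]
      · have h1 := degree_derivative_lt h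
        have h2 : q.degree ≤ i := by
          rw [Nat.cast_add, Nat.cast_one] at hq
          exact Order.le_of_lt_succ hq
        exact h1.trans_le h2
    simp only [e, eval_sub]
    rw [integral_sub (intervalIntegrable_eval _ _ _) (intervalIntegrable_eval _ _ _),
      integral_eval_derivative, ih (by omega) _ hq', eval_mul, eval_mul, h0 i (by omega),
      h1 i (by omega)]
    simp

theorem eval_iterate_derivative_eq_zero {w : ℝ[X]} {a : ℝ} {n i : ℕ} (h : (X - C a) ^ n ∣ w)
    (hi : i < n) : (derivative^[i] w).eval a = 0 := by
  have h1 := pow_sub_dvd_iterate_derivative_of_pow_dvd i h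
  have h2 : (X - C a) ∣ derivative^[i] w := (dvd_pow_self _ (by omega)).trans h1
  exact dvd_iff_isRoot.1 h2

/-- The Rodrigues weight `(x (1 - x)) ^ n`. -/
noncomputable def rodrigues (n : ℕ) : ℝ[X] := X ^ n * (1 - X) ^ n

/-- Rodrigues' formula. Any nonzero constant will do: only degree, orthogonality and zeros are used
later, never the normalisation. -/
theorem exists_legendre_eq (n : ℕ) :
    ∃ a : ℝ, a ≠ 0 ∧ legendre n = C a * derivative^[n] (rodrigues n) := by
  have h := congrArg (Polynomial.map (Int.castRingHom ℝ)) (factorial_mul_shiftedLegendre_eq n)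
  rw [← iterate_derivative_map] at h
  simp only [Polynomial.map_mul, Polynomial.map_natCast, Polynomial.map_pow, Polynomial.map_sub,
    Polynomial.map_one, Polynomial.map_X] at h
  have hn : (n.factorial : ℝ) ≠ 0 := by positivity
  refine ⟨(-1) ^ n * Real.sqrt (2 * n + 1) * (n.factorial : ℝ)⁻¹, ?_, ?_⟩
  · have : Real.sqrt (2 * n + 1) ≠ 0 := by positivity
    simp [this, hn]
  · rw [rodrigues, ← h, legendre, C_mul (b := (n.factorial : ℝ)⁻¹), mul_assoc (C _) (C _),
      ← mul_assoc (C _) (n.factorial : ℝ[X]), ← C_eq_natCast, ← C_mul, inv_mul_cancel₀ hn, C_1,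
      one_mul]

theorem natDegree_legendre (n : ℕ) : (legendre n).natDegree = n := by
  have : Real.sqrt (2 * n + 1) ≠ 0 := by positivity
  rw [legendre, natDegree_C_mul (by simp [this]),
    natDegree_map_eq_of_injective (RingHom.injective_int _), natDegree_shiftedLegendre]

theorem legendre_ne_zero (n : ℕ) : legendre n ≠ 0 := by
  have : Real.sqrt (2 * n + 1) ≠ 0 := by positivity
  refine mul_ne_zero (by simp [this]) ?_
  rw [Ne, Polynomial.map_eq_zero_iff (RingHom.injective_int _)]
  intro h
  have := degree_shiftedLegendre n
  simp [h] at this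

theorem integral_legendre_mul_eq_zero {n : ℕ} {q : ℝ[X]} (hq : q.degree < n) :
    ∫ x in (0 : ℝ)..1, (legendre n * q).eval x = 0 := by
  obtain ⟨a, -, ha⟩ := exists_legendre_eq n
  have h := integral_iterate_derivative_mul_eq_zero (w := rodrigues n) (n := n)
    (fun i hi => eval_iterate_derivative_eq_zero (n := n) (by simp [rodrigues]) hi)
    (fun i hi => eval_iterate_derivative_eq_zero (n := n) (by
      have : (X - C 1 : ℝ[X]) ∣ 1 - X := ⟨-1, by simp⟩
      exact (pow_dvd_pow_of_dvd this n).mul_left _) hi) n le_rfl q hq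
  rw [ha]
  simp only [mul_assoc, eval_mul (p := C a), eval_C]
  rw [integral_const_mul, h, mul_zero]

/-! ### Zeros -/

theorem card_roots_le_iterate_derivative (p : ℝ[X]) (n : ℕ) :
    p.roots.card ≤ (derivative^[n] p).roots.card + n := by
  induction n with
  | zero => simp
  | succ n ih =>
    rw [Function.iterate_succ_apply']
    have := card_roots_le_derivative (derivative^[n] p)
    omega

/-- By Rolle a derivative loses at most one root, with multiplicity. The Rodrigues weight has 2n
roots, so at least n survive n derivatives; the degree forbids more. -/
theorem card_roots_legendre (n : ℕ) : (legendre n).roots.card = n := by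
  refine le_antisymm ((card_roots' _).trans (natDegree_legendre n).le) ?_
  obtain ⟨a, ha, h⟩ := exists_legendre_eq n
  rw [h, roots_C_mul _ ha]
  have h1 := card_roots_le_iterate_derivative (rodrigues n) n
  have h2 : (rodrigues n).roots.card = 2 * n := by
    have e : (1 - X : ℝ[X]) = C (-1) * (X - C 1) := by simp
    have hne : (X ^ n * (1 - X) ^ n : ℝ[X]) ≠ 0 :=
      mul_ne_zero (pow_ne_zero _ X_ne_zero) (pow_ne_zero _ (by
        rw [e]; exact mul_ne_zero (by simp) (X_sub_C_ne_zero _)))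
    rw [rodrigues, roots_mul hne, roots_pow, roots_pow, roots_X, e, roots_C_mul _ (by norm_num),
      roots_X_sub_C]
    simp; ring
  omega

theorem integral_eval_pos {p : ℝ[X]} (hp : p ≠ 0) (h : ∀ x ∈ Set.Ioo (0 : ℝ) 1, 0 ≤ p.eval x) :
    0 < ∫ x in (0 : ℝ)..1, p.eval x := by
  have h' : ∀ x ∈ Set.Icc (0 : ℝ) 1, 0 ≤ p.eval x := by
    intro x hx
    rw [← closure_Ioo (zero_ne_one' ℝ)] at hx
    exact closure_minimal (s := Set.Ioo (0 : ℝ) 1) (t := {x | 0 ≤ p.eval x}) h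
      (isClosed_le continuous_const p.continuous) hx
  refine integral_pos zero_lt_one p.continuous.continuousOn
    (fun x hx => h' x ⟨hx.1.le, hx.2⟩) ?_
  by_contra! hc
  refine hp (eq_zero_of_infinite_isRoot p ((Set.Icc_infinite (zero_lt_one' ℝ)).mono ?_))
  exact fun x hx => le_antisymm (hc x hx) (h' x hx)

/-- The quotient q has degree below n. If g keeps one sign on (0, 1), so does g q², contradicting
the zero integral. Taking g = X - r excludes roots outside (0, 1), and g = (X - r)² excludes
multiple roots. -/
theorem legendre_orthogonal_quotient {n : ℕ} {q g : ℝ[X]} (h : legendre n = g * q)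
    (hg : 0 < g.natDegree) : ∫ x in (0 : ℝ)..1, (g * q * q).eval x = 0 := by
  rw [← h]
  have h0 : g * q ≠ 0 := h ▸ legendre_ne_zero n
  have hd : g.natDegree + q.natDegree = n := by
    rw [← natDegree_mul (left_ne_zero_of_mul h0) (right_ne_zero_of_mul h0), ← h,
      natDegree_legendre]
  apply integral_legendre_mul_eq_zero
  rw [degree_eq_natDegree (right_ne_zero_of_mul h0)]
  exact_mod_cast (by omega : q.natDegree < n)

theorem mem_Ioo_of_isRoot_legendre {n : ℕ} {r : ℝ} (hr : (legendre n).IsRoot r) :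
    r ∈ Set.Ioo (0 : ℝ) 1 := by
  obtain ⟨q, hq⟩ := dvd_iff_isRoot.2 hr
  have h := legendre_orthogonal_quotient hq (by simp)
  have h0 : (X - C r) * q ≠ 0 := hq ▸ legendre_ne_zero n
  have hq0 := right_ne_zero_of_mul h0
  by_contra hc
  rw [Set.mem_Ioo, not_and_or, not_lt, not_lt] at hc
  rcases hc with hc | hc
  · refine (integral_eval_pos (mul_ne_zero h0 hq0) fun x hx => ?_).ne' h
    have : 0 ≤ x - r := by linarith [hx.1]
    simp only [eval_mul, eval_sub, eval_X, eval_C, mul_assoc]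
    exact mul_nonneg this (mul_self_nonneg _)
  · refine (integral_eval_pos (neg_ne_zero.2 (mul_ne_zero h0 hq0)) fun x hx => ?_).ne' ?_
    · have : 0 ≤ r - x := by linarith [hx.2]
      have := mul_nonneg this (mul_self_nonneg (q.eval x))
      simp only [eval_neg, eval_mul, eval_sub, eval_X, eval_C]
      linarith
    · simp only [eval_neg]
      rw [integral_neg, h, neg_zero]

theorem nodup_roots_legendre (n : ℕ) : (legendre n).roots.Nodup := by
  rw [Multiset.nodup_iff_count_le_one]
  intro r
  by_contra! hc
  rw [count_roots] at hc
  obtain ⟨q, hq⟩ : (X - C r) ^ 2 ∣ legendre n :=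
    (pow_dvd_pow _ hc).trans (pow_rootMultiplicity_dvd _ _)
  have h0 : (X - C r) ^ 2 * q ≠ 0 := hq ▸ legendre_ne_zero n
  refine (integral_eval_pos (mul_ne_zero h0 (right_ne_zero_of_mul h0)) fun x _ => ?_).ne'
    (legendre_orthogonal_quotient hq (by simp [natDegree_pow]))
  have : (((X - C r) ^ 2 * q * q).eval x) = ((x - r) * q.eval x) ^ 2 := by simp; ring
  rw [this]
  positivity

theorem card_gaussNodes (k : ℕ) : (gaussNodes k).card = k := by
  rw [gaussNodes, Multiset.toFinset_card_of_nodup (nodup_roots_legendre k), card_roots_legendre]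

theorem eval_legendre_of_mem_gaussNodes {k : ℕ} {c : ℝ} (hc : c ∈ gaussNodes k) :
    (legendre k).eval c = 0 :=
  isRoot_of_mem_roots (Multiset.mem_toFinset.1 hc)

theorem mem_Icc_of_mem_gaussNodes {k : ℕ} {c : ℝ} (hc : c ∈ gaussNodes k) :
    c ∈ Set.Icc (0 : ℝ) 1 :=
  Set.Ioo_subset_Icc_self (mem_Ioo_of_isRoot_legendre (eval_legendre_of_mem_gaussNodes hc))

/-! ### Exactness of the Gauss-Legendre formula -/

theorem integral_eq_sum_of_degree_lt {k : ℕ} {p : ℝ[X]} (hp : p.degree < k) :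
    ∫ x in (0 : ℝ)..1, p.eval x = ∑ c ∈ gaussNodes k, gaussWeight k c * p.eval c := by
  have h := Lagrange.eq_interpolate (s := gaussNodes k) (v := id) (f := p)
    Function.injective_id.injOn (by rwa [card_gaussNodes])
  rw [Lagrange.interpolate_apply] at h
  conv_lhs => rw [h]
  simp only [eval_finsetSum, eval_mul, eval_C]
  rw [integral_finsetSum fun c _ => (intervalIntegrable_eval _ _ _).const_mul _]
  refine Finset.sum_congr rfl fun c _ => ?_
  rw [integral_const_mul, mul_comm]
  rfl

/-- Divide p by P_k. The quotient has degree below k, so its product with P_k integrates to zero,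
and the remainder agrees with p at the nodes. -/
theorem integral_eq_sum_of_degree_lt_two_mul {k : ℕ} {p : ℝ[X]} (hp : p.degree < (2 * k : ℕ)) :
    ∫ x in (0 : ℝ)..1, p.eval x = ∑ c ∈ gaussNodes k, gaussWeight k c * p.eval c := by
  have hk := degree_eq_natDegree (legendre_ne_zero k)
  rw [natDegree_legendre] at hk
  have hr : (p % legendre k).degree < k := hk ▸ degree_mod_lt p (legendre_ne_zero k)
  have hq : (p / legendre k).degree < k := by
    by_cases h0 : p / legendre k = 0
    · simp [h0]
    by_cases hkp : (legendre k).degree ≤ p.degree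
    · have h := degree_add_div (legendre_ne_zero k) hkp
      rw [degree_eq_natDegree h0] at h ⊢
      rw [← h, hk] at hp
      norm_cast at hp ⊢
      omega
    · exact absurd (Polynomial.div_eq_zero_iff (legendre_ne_zero k) |>.2 (not_le.1 hkp)) h0
  have e := EuclideanDomain.div_add_mod p (legendre k)
  conv_lhs => rw [← e]
  simp only [eval_add]
  rw [integral_add (intervalIntegrable_eval _ _ _) (intervalIntegrable_eval _ _ _),
    integral_legendre_mul_eq_zero hq, zero_add, integral_eq_sum_of_degree_lt hr]
  refine Finset.sum_congr rfl fun c hc => ?_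
  conv_rhs => rw [← e]
  rw [eval_add, eval_mul, eval_legendre_of_mem_gaussNodes hc, zero_mul, zero_add]

/-! ### Taylor expansion and quadrature along slow curves -/

section Curves

variable {E W : Type*} [NormedAddCommGroup E] [NormedSpace ℝ E]
  [NormedAddCommGroup W] [NormedSpace ℝ W]

/-- On `[0, 1]` the curve `v` stays in `K`, and its `i`-th derivative is at most `(M h) ^ i` in norm
for `1 ≤ i ≤ n`. -/
structure IsSlowCurve (K : Set E) (M : ℝ) (n : ℕ) (h : ℝ) (v : ℝ → E) : Prop where
  contDiff : ContDiff ℝ n v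
  mapsTo : Set.MapsTo v (Set.Icc 0 1) K
  norm_le : ∀ i, 1 ≤ i → i ≤ n → ∀ x ∈ Set.Icc (0 : ℝ) 1, ‖iteratedDeriv i v x‖ ≤ (M * h) ^ i

theorem IsSlowCurve.of_le {K : Set E} {M : ℝ} {n n' : ℕ} {h : ℝ} {v : ℝ → E}
    (hv : IsSlowCurve K M n h v) (hn : n' ≤ n) : IsSlowCurve K M n' h v :=
  ⟨hv.contDiff.of_le (by exact_mod_cast hn), hv.mapsTo,
    fun i h1 hi => hv.norm_le i h1 (hi.trans hn)⟩

theorem exists_bound_iteratedFDerivWithin {F : E → W} {D K : Set E} {n : ℕ} (hD : IsOpen D)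
    (hF : ContDiffOn ℝ n F D) (hK : IsCompact K) (hKD : K ⊆ D) :
    ∃ C : ℝ, 0 ≤ C ∧ ∀ i ≤ n, ∀ y ∈ K, ‖iteratedFDerivWithin ℝ i F D y‖ ≤ C := by
  have h : ∀ i ≤ n, ∃ C : ℝ, ∀ y ∈ K, ‖iteratedFDerivWithin ℝ i F D y‖ ≤ C := fun i hi =>
    hK.exists_bound_of_continuousOn
      ((hF.continuousOn_iteratedFDerivWithin (by exact_mod_cast hi) hD.uniqueDiffOn).mono hKD)
  choose! C hC using h
  refine ⟨∑ i ∈ Finset.range (n + 1), |C i|, Finset.sum_nonneg fun _ _ => abs_nonneg _,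
    fun i hi y hy => (hC i hi y hy).trans ((le_abs_self _).trans ?_)⟩
  exact Finset.single_le_sum (f := fun i => |C i|) (fun _ _ => abs_nonneg _)
    (Finset.mem_range.2 (by omega))

/-- A smooth function along a slow curve is a polynomial of degree less than `n`, up to
`O(h ^ n)`. -/
theorem exists_taylor_bound {F : E → W} {D K : Set E} {n : ℕ} (hD : IsOpen D)
    (hF : ContDiffOn ℝ n F D) (hK : IsCompact K) (hKD : K ⊆ D) {M : ℝ} (hM : 0 ≤ M) :
    ∃ C : ℝ, 0 ≤ C ∧ ∀ h : ℝ, 0 ≤ h → ∀ v : ℝ → E, IsSlowCurve K M n h v →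
      ∃ w : ℕ → W, ∀ x ∈ Set.Icc (0 : ℝ) 1,
        ‖F (v x) - ∑ q ∈ Finset.range n, x ^ q • w q‖ ≤ C * h ^ n := by
  obtain ⟨C, hC0, hC⟩ := exists_bound_iteratedFDerivWithin hD hF hK hKD
  refine ⟨n.factorial * C * M ^ n, by positivity, fun h hh v hv => ?_⟩
  have hmaps : Set.MapsTo v (Set.Icc 0 1) D := fun x hx => hKD (hv.mapsTo hx)
  have hu : UniqueDiffOn ℝ (Set.Icc (0 : ℝ) 1) := uniqueDiffOn_Icc zero_lt_one
  have hder : ∀ x ∈ Set.Icc (0 : ℝ) 1,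
      ‖iteratedDerivWithin n (F ∘ v) (Set.Icc 0 1) x‖ ≤ n.factorial * C * M ^ n * h ^ n := by
    intro x hx
    -- The bound takes the form n! C (M h)^n of the Faà di Bruno estimate for a composition.
    rw [← norm_iteratedFDerivWithin_eq_norm_iteratedDerivWithin, mul_assoc _ (M ^ n), ← mul_pow]
    refine norm_iteratedFDerivWithin_comp_le hF hv.contDiff.contDiffOn le_rfl hD.uniqueDiffOn hu
      hmaps hx (fun i hi => hC i hi _ (hv.mapsTo hx)) fun i h1 hi => ?_
    rw [norm_iteratedFDerivWithin_eq_norm_iteratedDerivWithin,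
      iteratedDerivWithin_eq_iteratedDeriv hu
        (hv.contDiff.of_le (by exact_mod_cast hi)).contDiffAt hx]
    exact hv.norm_le i h1 hi x hx
  -- Taylor's remainder bound has order n + 1, so order zero, with an empty sum, is separate.
  rcases n with _ | n
  · refine ⟨0, fun x hx => ?_⟩
    simpa using hder x hx
  · refine ⟨fun q => (q.factorial : ℝ)⁻¹ • iteratedDerivWithin q (F ∘ v) (Set.Icc 0 1) 0,
      fun x hx => ?_⟩
    have hcd : ContDiffOn ℝ (n + 1 : ℕ) (F ∘ v) (Set.Icc 0 1) :=
      hF.comp hv.contDiff.contDiffOn hmaps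
    have := taylor_mean_remainder_bound zero_le_one (by exact_mod_cast hcd) hx hder
    rw [taylor_within_apply] at this
    simp only [sub_zero, Function.comp_apply] at this
    simp only [smul_smul, mul_comm (_ ^ _ : ℝ) (_⁻¹)]
    refine this.trans ?_
    set A := ((n + 1).factorial : ℝ) * C * M ^ (n + 1) * h ^ (n + 1)
    have hA : 0 ≤ A := by positivity
    rw [div_le_iff₀ (by positivity)]
    have h1 : x ^ (n + 1) ≤ 1 := pow_le_one₀ hx.1 hx.2
    have h2 : (1 : ℝ) ≤ n.factorial := by exact_mod_cast n.factorial_pos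
    exact (mul_le_of_le_one_right hA h1).trans (le_mul_of_one_le_right hA h2)

theorem sum_smul_sum_pow (k n : ℕ) (p : ℝ[X]) (hp : p.natDegree + n ≤ 2 * k) (w : ℕ → W) :
    ∑ c ∈ gaussNodes k, (gaussWeight k c * p.eval c) • ∑ q ∈ Finset.range n, c ^ q • w q
      = ∑ q ∈ Finset.range n, (∫ x in (0 : ℝ)..1, (p * X ^ q).eval x) • w q := by
  simp only [Finset.smul_sum]
  rw [Finset.sum_comm]
  refine Finset.sum_congr rfl fun q hq => ?_
  have hq := Finset.mem_range.1 hq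
  have hd : (p * X ^ q).degree < ((2 * k : ℕ) : WithBot ℕ) := by
    by_cases h0 : p = 0
    · simp only [h0, zero_mul, degree_zero]
      exact WithBot.bot_lt_coe _
    rw [degree_mul, degree_X_pow, degree_eq_natDegree h0]
    exact_mod_cast (by omega : p.natDegree + q < 2 * k)
  rw [integral_eq_sum_of_degree_lt_two_mul hd, Finset.sum_smul]
  simp [smul_smul, mul_assoc]

theorem norm_sum_sub_le (k n : ℕ) (p : ℝ[X]) (hp : p.natDegree + n ≤ 2 * k) (w : ℕ → W)
    (G : ℝ → W) (ε : ℝ)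
    (hG : ∀ x ∈ Set.Icc (0 : ℝ) 1, ‖G x - ∑ q ∈ Finset.range n, x ^ q • w q‖ ≤ ε) :
    ‖∑ c ∈ gaussNodes k, (gaussWeight k c * p.eval c) • G c
      - ∑ q ∈ Finset.range n, (∫ x in (0 : ℝ)..1, (p * X ^ q).eval x) • w q‖
      ≤ (∑ c ∈ gaussNodes k, |gaussWeight k c * p.eval c|) * ε := by
  rw [← sum_smul_sum_pow k n p hp w, ← Finset.sum_sub_distrib, Finset.sum_mul]
  refine norm_sum_le_of_le _ fun c hc => ?_
  rw [← smul_sub, norm_smul, Real.norm_eq_abs]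
  exact mul_le_mul_of_nonneg_left (hG c (mem_Icc_of_mem_gaussNodes hc)) (abs_nonneg _)

theorem exists_eval_bound (p : ℝ[X]) :
    ∃ C : ℝ, 0 ≤ C ∧ ∀ x ∈ Set.Icc (0 : ℝ) 1, |p.eval x| ≤ C := by
  obtain ⟨C, hC⟩ := isCompact_Icc.exists_bound_of_continuousOn (p.continuous.continuousOn
    (s := Set.Icc (0 : ℝ) 1))
  exact ⟨C, (norm_nonneg _).trans (hC 0 (by simp)), hC⟩

/-- The quadrature of a smooth function along a slow curve against `P_i g` is small. -/
theorem exists_quadrature_bound {F : E → W} {D K : Set E} {n : ℕ} (hD : IsOpen D)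
    (hF : ContDiffOn ℝ n F D) (hK : IsCompact K) (hKD : K ⊆ D) {M : ℝ} (hM : 0 ≤ M)
    {i k : ℕ} (hik : i ≤ k) (g : ℝ[X]) (hg : g.natDegree + n ≤ i) :
    ∃ C : ℝ, 0 ≤ C ∧ ∀ h : ℝ, 0 ≤ h → ∀ v : ℝ → E, IsSlowCurve K M n h v →
      ‖∑ c ∈ gaussNodes k, (gaussWeight k c * (legendre i * g).eval c) • F (v c)‖ ≤ C * h ^ n := by
  obtain ⟨C, hC0, hC⟩ := exists_taylor_bound hD hF hK hKD hM
  refine ⟨(∑ c ∈ gaussNodes k, |gaussWeight k c * (legendre i * g).eval c|) * C,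
    mul_nonneg (Finset.sum_nonneg fun _ _ => abs_nonneg _) hC0, fun h hh v hv => ?_⟩
  obtain ⟨w, hw⟩ := hC h hh v hv
  have hp : (legendre i * g).natDegree + n ≤ 2 * k := by
    have := natDegree_mul_le (p := legendre i) (q := g)
    rw [natDegree_legendre] at this
    omega
  have := norm_sum_sub_le k n (legendre i * g) hp w (fun x => F (v x)) _ hw
  -- The Taylor part contributes nothing: g x^q has degree below i and is orthogonal to P_i.
  rw [Finset.sum_eq_zero (s := Finset.range n), sub_zero, ← mul_assoc] at this
  · exact this
  · intro q hq
    have hq := Finset.mem_range.1 hq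
    rw [mul_assoc, integral_legendre_mul_eq_zero, zero_smul]
    by_cases h0 : g = 0
    · simp only [h0, zero_mul, degree_zero]
      exact WithBot.bot_lt_coe _
    rw [degree_mul, degree_X_pow, degree_eq_natDegree h0]
    exact_mod_cast (by omega : g.natDegree + q < i)

theorem norm_integral_le_of_norm_le_unit {f : ℝ → E} {C : ℝ}
    (hf : ∀ x ∈ Set.Icc (0 : ℝ) 1, ‖f x‖ ≤ C) : ‖∫ x in (0 : ℝ)..1, f x‖ ≤ C := by
  have := norm_integral_le_of_norm_le_const (a := 0) (b := 1) (C := C) (f := f) fun x hx => by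
    rw [Set.uIoc_of_le zero_le_one] at hx
    exact hf x ⟨hx.1.le, hx.2⟩
  simpa using this

theorem sum_integral_smul [CompleteSpace E] (n : ℕ) (p : ℝ[X]) (w : ℕ → E) :
    ∑ q ∈ Finset.range n, (∫ x in (0 : ℝ)..1, (p * X ^ q).eval x) • w q
      = ∫ x in (0 : ℝ)..1, p.eval x • ∑ q ∈ Finset.range n, x ^ q • w q := by
  simp only [Finset.smul_sum]
  rw [integral_finsetSum]
  · refine Finset.sum_congr rfl fun q _ => ?_
    rw [← intervalIntegral.integral_smul_const]
    simp [smul_smul]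
  · intro q _
    have := p.continuous
    exact Continuous.intervalIntegrable (by fun_prop) _ _

/-- The quadrature error of a smooth function along a slow curve against a polynomial. -/
theorem exists_quadrature_error_bound [CompleteSpace W] {F : E → W} {D K : Set E} {n : ℕ}
    (hD : IsOpen D) (hF : ContDiffOn ℝ n F D) (hK : IsCompact K) (hKD : K ⊆ D) {M : ℝ}
    (hM : 0 ≤ M) {k : ℕ} (p : ℝ[X]) (hp : p.natDegree + n ≤ 2 * k) :
    ∃ C : ℝ, 0 ≤ C ∧ ∀ h : ℝ, 0 ≤ h → ∀ v : ℝ → E, IsSlowCurve K M n h v →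
      ‖(∫ x in (0 : ℝ)..1, p.eval x • F (v x))
        - ∑ c ∈ gaussNodes k, (gaussWeight k c * p.eval c) • F (v c)‖ ≤ C * h ^ n := by
  obtain ⟨C, hC0, hC⟩ := exists_taylor_bound hD hF hK hKD hM
  obtain ⟨A, hA0, hA⟩ := exists_eval_bound p
  refine ⟨A * C + (∑ c ∈ gaussNodes k, |gaussWeight k c * p.eval c|) * C,
    add_nonneg (mul_nonneg hA0 hC0)
      (mul_nonneg (Finset.sum_nonneg fun _ _ => abs_nonneg _) hC0), fun h hh v hv => ?_⟩
  obtain ⟨w, hw⟩ := hC h hh v hv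
  have h1 := norm_sum_sub_le k n p hp w (fun x => F (v x)) _ hw
  have hFv : ContinuousOn (fun x => F (v x)) (Set.Icc 0 1) :=
    hF.continuousOn.comp hv.contDiff.continuous.continuousOn fun x hx => hKD (hv.mapsTo hx)
  have hint : IntervalIntegrable (fun x => p.eval x • F (v x)) MeasureTheory.volume 0 1 := by
    refine ContinuousOn.intervalIntegrable ?_
    rw [Set.uIcc_of_le zero_le_one]
    exact p.continuous.continuousOn.smul hFv
  have e := sum_integral_smul (E := W) n p w
  have hint2 : IntervalIntegrable (fun x => p.eval x • ∑ q ∈ Finset.range n, x ^ q • w q)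
      MeasureTheory.volume 0 1 := by
    have := p.continuous
    exact Continuous.intervalIntegrable (by fun_prop) _ _
  have h2 : ‖(∫ x in (0 : ℝ)..1, p.eval x • F (v x))
      - ∑ q ∈ Finset.range n, (∫ x in (0 : ℝ)..1, (p * X ^ q).eval x) • w q‖
      ≤ A * (C * h ^ n) := by
    rw [e, ← integral_sub hint hint2]
    refine norm_integral_le_of_norm_le_unit (fun x hx => ?_)
    rw [← smul_sub, norm_smul, Real.norm_eq_abs]
    exact mul_le_mul (hA x hx) (hw x hx) (norm_nonneg _) hA0
  rw [norm_sub_rev] at h1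
  refine (norm_sub_le_norm_sub_add_norm_sub _ _ _).trans ((add_le_add h2 h1).trans (le_of_eq ?_))
  ring

/-- The polynomial curve `y₀ + h ∑_{i < s} (∫ x in 0..c, P_i x) a_i`. -/
noncomputable def polyCurve (s : ℕ) (h : ℝ) (y₀ : E) (a : ℕ → E) (c : ℝ) : E :=
  y₀ + h • ∑ i ∈ Finset.range s, (antiderivative (legendre i)).eval c • a i

theorem hasDerivAt_sum_eval_smul (s : ℕ) (p : ℕ → ℝ[X]) (a : ℕ → E) (c : ℝ) :
    HasDerivAt (fun c => ∑ i ∈ Finset.range s, (p i).eval c • a i)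
      (∑ i ∈ Finset.range s, (derivative (p i)).eval c • a i) c :=
  HasDerivAt.fun_sum fun i _ => ((p i).hasDerivAt c).smul_const (a i)

theorem hasDerivAt_polyCurve (s : ℕ) (h : ℝ) (y₀ : E) (a : ℕ → E) (c : ℝ) :
    HasDerivAt (polyCurve s h y₀ a) (h • ∑ i ∈ Finset.range s, (legendre i).eval c • a i) c := by
  have := ((hasDerivAt_sum_eval_smul s (fun i => antiderivative (legendre i)) a c).fun_const_smul
    h).const_add y₀
  simp only [derivative_antiderivative] at this
  exact this

theorem contDiff_polyCurve (s : ℕ) (h : ℝ) (y₀ : E) (a : ℕ → E) (n : ℕ) :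
    ContDiff ℝ n (polyCurve s h y₀ a) := by
  unfold polyCurve
  refine contDiff_const.add (contDiff_const.smul (ContDiff.sum fun i _ => ?_))
  exact (contDiff_aeval (antiderivative (legendre i)) n).smul contDiff_const

theorem iteratedDeriv_polyCurve (s : ℕ) (h : ℝ) (y₀ : E) (a : ℕ → E) (n : ℕ) :
    iteratedDeriv (n + 1) (polyCurve s h y₀ a)
      = fun c => h • ∑ i ∈ Finset.range s, (derivative^[n] (legendre i)).eval c • a i := by
  induction n with
  | zero =>
    rw [zero_add, iteratedDeriv_one]
    exact funext fun c => (hasDerivAt_polyCurve s h y₀ a c).deriv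
  | succ n ih =>
    rw [iteratedDeriv_succ, ih]
    funext c
    rw [((hasDerivAt_sum_eval_smul s (fun i => derivative^[n] (legendre i)) a c).fun_const_smul
      h).deriv]
    simp only [Function.iterate_succ_apply']

theorem exists_eval_iterate_derivative_bound (s n : ℕ) :
    ∃ C : ℝ, 1 ≤ C ∧ ∀ i < s, ∀ q ≤ n, ∀ x ∈ Set.Icc (0 : ℝ) 1,
      |(derivative^[q] (legendre i)).eval x| ≤ C := by
  choose C hC0 hC using fun i q => exists_eval_bound (derivative^[q] (legendre i))
  have hs : ∀ i, 0 ≤ ∑ q ∈ Finset.range (n + 1), C i q :=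
    fun i => Finset.sum_nonneg fun _ _ => hC0 _ _
  refine ⟨1 + ∑ i ∈ Finset.range s, ∑ q ∈ Finset.range (n + 1), C i q,
    le_add_of_nonneg_right (Finset.sum_nonneg fun i _ => hs i), fun i hi q hq x hx => ?_⟩
  refine (hC i q x hx).trans (((Finset.single_le_sum (f := fun q => C i q) (fun _ _ => hC0 _ _)
    (Finset.mem_range.2 (by omega))).trans (Finset.single_le_sum
    (f := fun i => ∑ q ∈ Finset.range (n + 1), C i q) (fun i _ => hs i)
    (Finset.mem_range.2 hi))).trans ?_)
  linarith

/-- If `a_i = O(h ^ min i r)` then `polyCurve` is slow up to the order `r + 1`. -/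
theorem exists_isSlowCurve (s r : ℕ) {A : ℝ} (hA : 0 ≤ A) :
    ∃ M : ℝ, 0 ≤ M ∧ ∀ h : ℝ, 0 ≤ h → h ≤ 1 → ∀ (y₀ : E) (a : ℕ → E) (K : Set E),
      (∀ i < s, ‖a i‖ ≤ A * h ^ min i r) →
      Set.MapsTo (polyCurve s h y₀ a) (Set.Icc 0 1) K →
      IsSlowCurve K M (r + 1) h (polyCurve s h y₀ a) := by
  obtain ⟨C, hC1, hC⟩ := exists_eval_iterate_derivative_bound s r
  have hC0 : 0 ≤ C := zero_le_one.trans hC1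
  -- The summand 1 makes every positive power of M dominate s C A.
  refine ⟨1 + s * (C * A), by positivity, fun h hh hh1 y₀ a K ha hK =>
    ⟨contDiff_polyCurve .., hK, fun i hi hin x hx => ?_⟩⟩
  obtain ⟨q, rfl⟩ : ∃ q, i = q + 1 := ⟨i - 1, by omega⟩
  rw [iteratedDeriv_polyCurve]
  have key : ‖∑ i ∈ Finset.range s, (derivative^[q] (legendre i)).eval x • a i‖
      ≤ s * (C * A) * h ^ q := by
    have : ∀ i ∈ Finset.range s, ‖(derivative^[q] (legendre i)).eval x • a i‖
        ≤ C * A * h ^ q := by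
      intro i hi
      have hi := Finset.mem_range.1 hi
      -- Differentiating P_i more than i times gives zero. The surviving indices have i ≥ q, and
      -- their coefficients are already O(h^q). The prefactor h of the curve gives the extra order.
      by_cases hqi : i < q
      · rw [iterate_derivative_eq_zero (by rwa [natDegree_legendre])]
        simp only [eval_zero, zero_smul, norm_zero]
        positivity
      · rw [norm_smul, Real.norm_eq_abs, mul_assoc]
        refine mul_le_mul (hC i hi q (by omega) x hx) ((ha i hi).trans ?_) (norm_nonneg _) hC0
        exact mul_le_mul_of_nonneg_left (pow_le_pow_of_le_one hh hh1 (by omega)) hA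
    refine (norm_sum_le_of_le _ this).trans (le_of_eq ?_)
    simp [mul_assoc]
  rw [norm_smul, Real.norm_of_nonneg hh, mul_pow]
  set T := (s : ℝ) * (C * A)
  have hT : 0 ≤ T := by positivity
  calc h * _ ≤ h * (T * h ^ q) := mul_le_mul_of_nonneg_left key hh
    _ = T * h ^ (q + 1) := by ring
    _ ≤ (1 + T) ^ (q + 1) * h ^ (q + 1) := by
      refine mul_le_mul_of_nonneg_right ?_ (by positivity)
      calc T ≤ (1 + T) ^ 1 := by linarith
        _ ≤ _ := pow_le_pow_right₀ (by linarith) (by omega)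

end Curves

/-! ### The method as a fixed-point equation on [0, 1] -/

section Method

variable {m : ℕ}

local notation "𝔼" => EuclideanSpace ℝ (Fin m)

/-- The vectors `∑_j ρ̂_ij γ̂_j` formed from the stages `U c`, `c ∈ gaussNodes k`. -/
noncomputable def stageCoeff (k s : ℕ) (B : 𝔼 → Matrix (Fin m) (Fin m) ℝ) (H : 𝔼 → ℝ)
    (U : ℝ → 𝔼) (i : ℕ) : 𝔼 :=
  ∑ j ∈ Finset.range s, Matrix.toEuclideanLin (rhoHat k B 1 U i j) (gammaHat k H 1 U j)

theorem gammaHat_eq (k : ℕ) (H : 𝔼 → ℝ) (U : ℝ → 𝔼) (j : ℕ) :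
    gammaHat k H 1 U j
      = ∑ c ∈ gaussNodes k, (gaussWeight k c * (legendre j).eval c) • gradient H (U c) := by
  simp [gammaHat]

theorem toEuclideanLin_rhoHat (k : ℕ) (B : 𝔼 → Matrix (Fin m) (Fin m) ℝ) (U : ℝ → 𝔼) (i j : ℕ)
    (x : 𝔼) : Matrix.toEuclideanLin (rhoHat k B 1 U i j) x
      = (∑ c ∈ gaussNodes k, (gaussWeight k c * (legendre i * legendre j).eval c) •
          Matrix.toEuclideanCLM (n := Fin m) (𝕜 := ℝ) (B (U c))) x := by
  rw [← Matrix.coe_toEuclideanCLM_eq_toEuclideanLin]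
  simp [rhoHat, mul_assoc]

theorem stageCoeff_congr {k s : ℕ} {B : 𝔼 → Matrix (Fin m) (Fin m) ℝ} {H : 𝔼 → ℝ}
    {U V : ℝ → 𝔼} (h : ∀ c ∈ gaussNodes k, U c = V c) :
    stageCoeff k s B H U = stageCoeff k s B H V := by
  have h1 : ∀ j, gammaHat k H 1 U j = gammaHat k H 1 V j := fun j =>
    Finset.sum_congr rfl fun c hc => by simp [h c hc]
  have h2 : ∀ i j, rhoHat k B 1 U i j = rhoHat k B 1 V i j := fun i j =>
    Finset.sum_congr rfl fun c hc => by simp [h c hc]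
  funext i
  simp only [stageCoeff, h1, h2]

/-- After rescaling time, the hatted coefficients can be taken with step 1; h remains only as the
prefactor of the polynomial curve. -/
theorem isPath_iff {k s : ℕ} {B : 𝔼 → Matrix (Fin m) (Fin m) ℝ} {H : 𝔼 → ℝ} {h : ℝ} {y₀ : 𝔼}
    {u : ℝ → 𝔼} : IsPath k s B H h y₀ u ↔ ∀ c ∈ Set.Icc (0 : ℝ) 1,
      u (c * h) = polyCurve s h y₀ (stageCoeff k s B H fun c => u (c * h)) c := by
  have h1 : ∀ j, gammaHat k H 1 (fun c => u (c * h)) j = gammaHat k H h u j := fun j => by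
    simp [gammaHat]
  have h2 : ∀ i j, rhoHat k B 1 (fun c => u (c * h)) i j = rhoHat k B h u i j := fun i j => by
    simp [rhoHat]
  simp only [IsPath, polyCurve, stageCoeff, h1, h2, integral_eval_eq, Finset.smul_sum]

theorem contDiffOn_gradient {H : 𝔼 → ℝ} {D : Set 𝔼} (hD : IsOpen D) {n : ℕ}
    (hH : ContDiffOn ℝ (n + 1 : ℕ) H D) : ContDiffOn ℝ n (gradient H) D :=
  (InnerProductSpace.toDual ℝ 𝔼).symm.contDiff.comp_contDiffOn
    (hH.fderiv_of_isOpen hD (by norm_cast))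

theorem contDiffOn_toEuclideanCLM {B : 𝔼 → Matrix (Fin m) (Fin m) ℝ} {D : Set 𝔼} {n : ℕ}
    (hB : ∀ p q, ContDiffOn ℝ n (fun y => B y p q) D) :
    ContDiffOn ℝ n (fun y => Matrix.toEuclideanCLM (n := Fin m) (𝕜 := ℝ) (B y)) D := by
  have : (fun y => Matrix.toEuclideanCLM (n := Fin m) (𝕜 := ℝ) (B y)) = fun y =>
      ∑ p, ∑ q, B y p q • Matrix.toEuclideanCLM (n := Fin m) (𝕜 := ℝ) (Matrix.single p q 1) := by
    funext y
    conv_lhs => rw [Matrix.matrix_eq_sum_single (B y)]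
    simp only [map_sum, ← map_smul, Matrix.smul_single, smul_eq_mul, mul_one]
  rw [this]
  exact ContDiffOn.sum fun p _ => ContDiffOn.sum fun q _ => (hB p q).smul contDiffOn_const

/-! ### Orders of magnitude of the coefficients -/

theorem exists_gammaHat_bound {H : 𝔼 → ℝ} {D K : Set 𝔼} (hD : IsOpen D) {n : ℕ}
    (hH : ContDiffOn ℝ n (gradient H) D) (hK : IsCompact K) (hKD : K ⊆ D) {M : ℝ} (hM : 0 ≤ M)
    {j k : ℕ} (hjk : j ≤ k) (hn : n ≤ j) :
    ∃ C : ℝ, 0 ≤ C ∧ ∀ h : ℝ, 0 ≤ h → ∀ v : ℝ → 𝔼, IsSlowCurve K M n h v →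
      ‖gammaHat k H 1 v j‖ ≤ C * h ^ n := by
  have := exists_quadrature_bound hD hH hK hKD hM hjk 1 (by simpa using hn)
  simpa only [mul_one, gammaHat_eq] using this

/-- Whichever of P_i, P_j has the larger degree serves as the orthogonal factor and the other as the
multiplier g, so any order n ≤ |i - j| is reached. -/
theorem exists_rhoHat_bound {B : 𝔼 → Matrix (Fin m) (Fin m) ℝ} {D K : Set 𝔼} (hD : IsOpen D)
    {n : ℕ} (hB : ∀ p q, ContDiffOn ℝ n (fun y => B y p q) D) (hK : IsCompact K) (hKD : K ⊆ D)
    {M : ℝ} (hM : 0 ≤ M) {i j k : ℕ} (hi : i ≤ k) (hj : j ≤ k) (hn : n + j ≤ i ∨ n + i ≤ j) :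
    ∃ C : ℝ, 0 ≤ C ∧ ∀ h : ℝ, 0 ≤ h → ∀ v : ℝ → 𝔼, IsSlowCurve K M n h v → ∀ x : 𝔼,
      ‖Matrix.toEuclideanLin (rhoHat k B 1 v i j) x‖ ≤ C * h ^ n * ‖x‖ := by
  have key : ∃ C : ℝ, 0 ≤ C ∧ ∀ h : ℝ, 0 ≤ h → ∀ v : ℝ → 𝔼, IsSlowCurve K M n h v →
      ‖∑ c ∈ gaussNodes k, (gaussWeight k c * (legendre i * legendre j).eval c) •
        Matrix.toEuclideanCLM (n := Fin m) (𝕜 := ℝ) (B (v c))‖ ≤ C * h ^ n := by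
    rcases hn with hn | hn
    · exact exists_quadrature_bound hD (contDiffOn_toEuclideanCLM hB) hK hKD hM hi (legendre j)
        (by rw [natDegree_legendre]; omega)
    · rw [mul_comm]
      exact exists_quadrature_bound hD (contDiffOn_toEuclideanCLM hB) hK hKD hM hj (legendre i)
        (by rw [natDegree_legendre]; omega)
  obtain ⟨C, hC0, hC⟩ := key
  refine ⟨C, hC0, fun h hh v hv x => ?_⟩
  rw [toEuclideanLin_rhoHat]
  exact ContinuousLinearMap.le_of_opNorm_le _ (hC h hh v hv) x

/-- The product ρ̂_ij γ̂_j has order |i - j| + j ≥ i, with every order capped at the available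
smoothness r. In truncated subtraction |i - j| is `i - j + (j - i)`. -/
theorem exists_stageCoeff_bound {H : 𝔼 → ℝ} {B : 𝔼 → Matrix (Fin m) (Fin m) ℝ} {D K : Set 𝔼}
    (hD : IsOpen D) {r : ℕ} (hH : ContDiffOn ℝ r (gradient H) D)
    (hB : ∀ p q, ContDiffOn ℝ r (fun y => B y p q) D) (hK : IsCompact K) (hKD : K ⊆ D)
    {M : ℝ} (hM : 0 ≤ M) {k s : ℕ} (hsk : s ≤ k) :
    ∃ A : ℝ, 0 ≤ A ∧ ∀ h : ℝ, 0 ≤ h → h ≤ 1 → ∀ v : ℝ → 𝔼, IsSlowCurve K M r h v →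
      ∀ i < s, ‖stageCoeff k s B H v i‖ ≤ A * h ^ min i r := by
  have hle : ∀ {n : ℕ}, n ≤ r → ((n : ℕ) : WithTop ℕ∞) ≤ r := fun h => by exact_mod_cast h
  have hg : ∀ j < s, ∃ C : ℝ, 0 ≤ C ∧ ∀ h : ℝ, 0 ≤ h → ∀ v : ℝ → 𝔼,
      IsSlowCurve K M (min j r) h v → ‖gammaHat k H 1 v j‖ ≤ C * h ^ min j r := fun j hj =>
    exists_gammaHat_bound hD (hH.of_le (hle (min_le_right _ _))) hK hKD hM (by omega)
      (min_le_left _ _)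
  have hr : ∀ i < s, ∀ j < s, ∃ C : ℝ, 0 ≤ C ∧ ∀ h : ℝ, 0 ≤ h → ∀ v : ℝ → 𝔼,
      IsSlowCurve K M (min (i - j + (j - i)) r) h v → ∀ x : 𝔼,
      ‖Matrix.toEuclideanLin (rhoHat k B 1 v i j) x‖
        ≤ C * h ^ min (i - j + (j - i)) r * ‖x‖ := fun i hi j hj =>
    exists_rhoHat_bound hD (fun p q => (hB p q).of_le (hle (min_le_right _ _))) hK hKD hM
      (by omega) (by omega) (by omega)
  choose! G hG0 hG using hg
  choose! R hR0 hR using hr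
  have hRG : ∀ i < s, ∀ j < s, 0 ≤ R i j * G j := fun i hi j hj =>
    mul_nonneg (hR0 i hi j hj) (hG0 j hj)
  have hsum : ∀ i ∈ Finset.range s, 0 ≤ ∑ j ∈ Finset.range s, R i j * G j := fun i hi =>
    Finset.sum_nonneg fun j hj => hRG i (Finset.mem_range.1 hi) j (Finset.mem_range.1 hj)
  refine ⟨∑ i ∈ Finset.range s, ∑ j ∈ Finset.range s, R i j * G j, Finset.sum_nonneg hsum,
    fun h hh hh1 v hv i hi => ?_⟩
  have h1 : ∀ j ∈ Finset.range s,
      ‖Matrix.toEuclideanLin (rhoHat k B 1 v i j) (gammaHat k H 1 v j)‖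
        ≤ R i j * G j * h ^ min i r := by
    intro j hj
    have hj := Finset.mem_range.1 hj
    have hRij := hR0 i hi j hj
    calc _ ≤ R i j * h ^ min (i - j + (j - i)) r * ‖gammaHat k H 1 v j‖ :=
          hR i hi j hj h hh v (hv.of_le (min_le_right _ _)) _
      _ ≤ R i j * h ^ min (i - j + (j - i)) r * (G j * h ^ min j r) :=
          mul_le_mul_of_nonneg_left (hG j hj h hh v (hv.of_le (min_le_right _ _)))
            (by positivity)
      _ = R i j * G j * h ^ (min (i - j + (j - i)) r + min j r) := by ring
      _ ≤ R i j * G j * h ^ min i r :=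
          mul_le_mul_of_nonneg_left (pow_le_pow_of_le_one hh hh1 (by omega)) (hRG i hi j hj)
  refine (norm_sum_le_of_le _ h1).trans ?_
  rw [← Finset.sum_mul]
  exact mul_le_mul_of_nonneg_right
    (Finset.single_le_sum (f := fun i => ∑ j ∈ Finset.range s, R i j * G j) hsum
      (Finset.mem_range.2 hi)) (by positivity)

/-- The curves produced by the method are slow, uniformly in the step. -/
theorem exists_isSlowCurve_of_fixed {H : 𝔼 → ℝ} {B : 𝔼 → Matrix (Fin m) (Fin m) ℝ}
    {D K : Set 𝔼} (hD : IsOpen D) {n : ℕ} (hH : ContDiffOn ℝ n (gradient H) D)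
    (hB : ∀ p q, ContDiffOn ℝ n (fun y => B y p q) D) (hK : IsCompact K) (hKD : K ⊆ D)
    {k s : ℕ} (hsk : s ≤ k) (y₀ : 𝔼) :
    ∀ r ≤ n, ∃ M : ℝ, 0 ≤ M ∧ ∀ h : ℝ, 0 ≤ h → h ≤ 1 → ∀ v : ℝ → 𝔼,
      v = polyCurve s h y₀ (stageCoeff k s B H v) → Set.MapsTo v (Set.Icc 0 1) K →
      IsSlowCurve K M r h v := by
  intro r
  induction r with
  | zero =>
    refine fun _ => ⟨0, le_rfl, fun h _ _ v hv hvK => ⟨?_, hvK, fun i h1 h2 => by omega⟩⟩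
    rw [hv]
    exact contDiff_polyCurve ..
  | succ r ih =>
    intro hr
    have hle : ((r : ℕ) : WithTop ℕ∞) ≤ n := by exact_mod_cast (by omega : r ≤ n)
    -- Bootstrap: slowness of order r bounds the coefficients by O(h^min(i, r)), which in turn
    -- yields slowness of order r + 1.
    obtain ⟨M, hM, hslow⟩ := ih (by omega)
    obtain ⟨A, hA, hcoeff⟩ := exists_stageCoeff_bound hD (hH.of_le hle)
      (fun p q => (hB p q).of_le hle) hK hKD hM hsk
    obtain ⟨M', hM', hslow'⟩ := exists_isSlowCurve (E := 𝔼) s r hA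
    refine ⟨M', hM', fun h hh hh1 v hv hvK => ?_⟩
    have := hslow' h hh hh1 y₀ (stageCoeff k s B H v) K
      (hcoeff h hh hh1 v (hslow h hh hh1 v hv hvK))
    rw [← hv] at this
    exact this hvK

/-! ### Conservation of the Hamiltonian -/

theorem inner_toEuclideanLin_eq_neg {A : Matrix (Fin m) (Fin m) ℝ} (hA : A.transpose = -A)
    (x y : 𝔼) : inner ℝ x (Matrix.toEuclideanLin A y) = -inner ℝ y (Matrix.toEuclideanLin A x) := by
  have h : A.conjTranspose = -A := by rw [Matrix.conjTranspose_eq_transpose_of_trivial, hA]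
  have h2 := congrArg Matrix.toEuclideanLin h
  rw [Matrix.toEuclideanLin_conjTranspose_eq_adjoint, map_neg] at h2
  rw [← LinearMap.adjoint_inner_left, h2, LinearMap.neg_apply, inner_neg_left, real_inner_comm]

/-- The numbers ⟨γ̂_i, ρ̂_ij γ̂_j⟩ are antisymmetric in (i, j), so their double sum equals its own
negative. Skewness of B is needed at the stages only. -/
theorem sum_inner_gammaHat_stageCoeff {k s : ℕ} {B : 𝔼 → Matrix (Fin m) (Fin m) ℝ} {H : 𝔼 → ℝ}
    {U : ℝ → 𝔼} (hB : ∀ c ∈ gaussNodes k, (B (U c)).transpose = -B (U c)) :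
    ∑ i ∈ Finset.range s, inner ℝ (gammaHat k H 1 U i) (stageCoeff k s B H U i) = 0 := by
  have hskew : ∀ i j, (rhoHat k B 1 U i j).transpose = -rhoHat k B 1 U i j := by
    intro i j
    simp only [rhoHat, Matrix.transpose_sum, Matrix.transpose_smul, mul_one]
    rw [← Finset.sum_neg_distrib]
    exact Finset.sum_congr rfl fun c hc => by rw [hB c hc, smul_neg]
  have hsymm : ∀ i j, rhoHat k B 1 U i j = rhoHat k B 1 U j i := fun i j =>
    Finset.sum_congr rfl fun c _ => by rw [mul_right_comm]
  simp only [stageCoeff, inner_sum]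
  set f : ℕ → ℕ → ℝ := fun i j => inner ℝ (gammaHat k H 1 U i)
    (Matrix.toEuclideanLin (rhoHat k B 1 U i j) (gammaHat k H 1 U j)) with hf
  have h1 : ∀ i j, f i j = -f j i := fun i j => by
    simp only [hf]
    rw [inner_toEuclideanLin_eq_neg (hskew i j), hsymm i j]
  have h2 : ∑ i ∈ Finset.range s, ∑ j ∈ Finset.range s, f i j
      = -∑ i ∈ Finset.range s, ∑ j ∈ Finset.range s, f i j := by
    conv_lhs => rw [Finset.sum_comm]
    simp only [← Finset.sum_neg_distrib]
    exact Finset.sum_congr rfl fun j _ => Finset.sum_congr rfl fun i _ => h1 i j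
  linarith

/-- The fundamental theorem of calculus for H along the curve, whose derivative is h ∑ P_i a_i. The
coefficients a_i are arbitrary here. -/
theorem hamiltonian_sub_eq {H : 𝔼 → ℝ} {D : Set 𝔼} (hD : IsOpen D) (hH : DifferentiableOn ℝ H D)
    (hg : ContinuousOn (gradient H) D) (s : ℕ) (h : ℝ) (y₀ : 𝔼) (a : ℕ → 𝔼)
    (hv : Set.MapsTo (polyCurve s h y₀ a) (Set.Icc 0 1) D) :
    H (polyCurve s h y₀ a 1) - H (polyCurve s h y₀ a 0)
      = h * ∑ i ∈ Finset.range s, inner ℝ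
        (∫ x in (0 : ℝ)..1, (legendre i).eval x • gradient H (polyCurve s h y₀ a x)) (a i) := by
  set v := polyCurve s h y₀ a with hvdef
  have hgv : ContinuousOn (fun x => gradient H (v x)) (Set.uIcc 0 1) := by
    rw [Set.uIcc_of_le zero_le_one]
    exact hg.comp (contDiff_polyCurve s h y₀ a 0).continuous.continuousOn hv
  have hint : ∀ i, IntervalIntegrable (fun x => (legendre i).eval x • gradient H (v x))
      MeasureTheory.volume 0 1 := fun i =>
    ((legendre i).continuous.continuousOn.smul hgv).intervalIntegrable
  have hderiv : ∀ x ∈ Set.uIcc (0 : ℝ) 1, HasDerivAt (fun x => H (v x))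
      (∑ i ∈ Finset.range s, h * inner ℝ (a i) ((legendre i).eval x • gradient H (v x))) x := by
    intro x hx
    rw [Set.uIcc_of_le zero_le_one] at hx
    have h1 := (hH.differentiableAt (hD.mem_nhds (hv hx))).hasGradientAt
    have h2 := h1.hasFDerivAt.comp_hasDerivAt x (hasDerivAt_polyCurve s h y₀ a x)
    refine h2.congr_deriv ?_
    rw [InnerProductSpace.toDual_apply_apply, inner_smul_right, inner_sum, Finset.mul_sum]
    refine Finset.sum_congr rfl fun i _ => ?_
    rw [inner_smul_right, inner_smul_right, real_inner_comm]
  have hint' : ∀ i, IntervalIntegrable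
      (fun x => inner ℝ (a i) ((legendre i).eval x • gradient H (v x)))
      MeasureTheory.volume 0 1 := fun i =>
    (continuousOn_const.inner ((legendre i).continuous.continuousOn.smul hgv)).intervalIntegrable
  rw [← integral_eq_sub_of_hasDerivAt hderiv
    (by simpa only [Finset.sum_fn] using
      IntervalIntegrable.sum (Finset.range s) fun i _ => (hint' i).const_mul h),
    integral_finsetSum fun i _ => (hint' i).const_mul h, Finset.mul_sum]
  refine Finset.sum_congr rfl fun i _ => ?_
  rw [integral_const_mul, real_inner_comm]
  congr 1
  exact (innerSL ℝ (a i)).intervalIntegral_comp_comm (hint i)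

theorem exists_energy_bound {H : 𝔼 → ℝ} {B : 𝔼 → Matrix (Fin m) (Fin m) ℝ} {D K : Set 𝔼}
    (hD : IsOpen D) {k s : ℕ} (hsk : s ≤ k) (hH : ContDiffOn ℝ (2 * k + 1 : ℕ) H D)
    (hB : ∀ p q, ContDiffOn ℝ (2 * k : ℕ) (fun y => B y p q) D)
    (hskew : ∀ y ∈ D, (B y).transpose = -B y) (hK : IsCompact K) (hKD : K ⊆ D) (y₀ : 𝔼) :
    ∃ C : ℝ, ∀ h : ℝ, 0 ≤ h → h ≤ 1 → ∀ v : ℝ → 𝔼,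
      v = polyCurve s h y₀ (stageCoeff k s B H v) → Set.MapsTo v (Set.Icc 0 1) K →
      |H (v 1) - H y₀| ≤ C * h ^ (2 * k + 1) := by
  have hg := contDiffOn_gradient hD hH
  obtain ⟨M, hM, hslow⟩ := exists_isSlowCurve_of_fixed hD hg hB hK hKD hsk y₀ _ le_rfl
  obtain ⟨A, hA, hcoeff⟩ := exists_stageCoeff_bound hD hg hB hK hKD hM hsk
  -- The order 2k - i is the largest that the quadrature allows against P_i, of degree i.
  have herr : ∀ i < s, ∃ C : ℝ, 0 ≤ C ∧ ∀ h : ℝ, 0 ≤ h → ∀ v : ℝ → 𝔼,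
      IsSlowCurve K M (2 * k - i) h v →
      ‖(∫ x in (0 : ℝ)..1, (legendre i).eval x • gradient H (v x)) - gammaHat k H 1 v i‖
        ≤ C * h ^ (2 * k - i) := by
    intro i hi
    simp only [gammaHat_eq]
    exact exists_quadrature_error_bound hD
      (hg.of_le (by exact_mod_cast Nat.sub_le _ _)) hK hKD hM (legendre i)
      (by rw [natDegree_legendre]; omega)
  choose! E hE0 hE using herr
  refine ⟨∑ i ∈ Finset.range s, E i * A, fun h hh hh1 v hv hvK => ?_⟩
  have hs := hslow h hh hh1 v hv hvK
  have h0 : v 0 = y₀ := by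
    rw [hv]
    simp [polyCurve, eval_zero_antiderivative]
  have henergy := hamiltonian_sub_eq hD (hH.differentiableOn (by simp)) hg.continuousOn s h y₀
    (stageCoeff k s B H v) (by rw [← hv]; exact fun x hx => hKD (hvK hx))
  rw [← hv, h0] at henergy
  have hcons := sum_inner_gammaHat_stageCoeff (k := k) (s := s) (B := B) (H := H) (U := v)
    fun c hc => hskew _ (hKD (hvK (mem_Icc_of_mem_gaussNodes hc)))
  have hdiff : H (v 1) - H y₀ = h * ∑ i ∈ Finset.range s, inner ℝ
      ((∫ x in (0 : ℝ)..1, (legendre i).eval x • gradient H (v x)) - gammaHat k H 1 v i)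
      (stageCoeff k s B H v i) := by
    simp only [inner_sub_left, Finset.sum_sub_distrib]
    rw [henergy, hcons, sub_zero]
  rw [hdiff, abs_mul,
    abs_of_nonneg hh, pow_succ, ← mul_assoc, mul_comm h]
  refine mul_le_mul_of_nonneg_right ((Finset.abs_sum_le_sum_abs _ _).trans ?_) hh
  rw [Finset.sum_mul]
  refine Finset.sum_le_sum fun i hi => ?_
  have hi := Finset.mem_range.1 hi
  have h1 := hE i hi h hh v (hs.of_le (Nat.sub_le _ _))
  have h2 := hcoeff h hh hh1 v hs i hi
  -- The cap 2k is inactive, since i < s ≤ k.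
  rw [min_eq_left (by omega)] at h2
  have hEi := hE0 i hi
  calc _ ≤ _ := abs_real_inner_le_norm _ _
    _ ≤ (E i * h ^ (2 * k - i)) * (A * h ^ i) := mul_le_mul h1 h2 (norm_nonneg _) (by positivity)
    _ = E i * A * h ^ (2 * k - i + i) := by ring
    _ = E i * A * h ^ (2 * k) := by rw [Nat.sub_add_cancel (by omega)]

end Method

/-- A small multiple of a locally Lipschitz map has a fixed point near the base point. -/
theorem exists_fixed_of_lipschitzOnWith {X : Type*} [NormedAddCommGroup X] [NormedSpace ℝ X]
    [CompleteSpace X] {f : X → X} {x₀ : X} {t : Set X} {L : NNReal} (ht : t ∈ nhds x₀)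
    (hf : LipschitzOnWith L f t) :
    ∃ h₀ > (0 : ℝ), ∀ h : ℝ, 0 < h → h ≤ h₀ → ∃ x ∈ t, x = x₀ + h • f x := by
  obtain ⟨ρ, hρ, hball⟩ := Metric.nhds_basis_closedBall.mem_iff.1 ht
  set N : ℝ := ‖f x₀‖ + L * ρ + 1 with hN
  have hN0 : 0 < N := by positivity
  -- N bounds f on the ball. The first entry makes the ball invariant, the second gives contraction
  -- factor 1/2.
  refine ⟨min (ρ / N) (1 / (2 * (L + 1))), by positivity, fun h hh hle => ?_⟩
  have h1 : h * N ≤ ρ := (le_div_iff₀ hN0).1 (hle.trans (min_le_left _ _))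
  have h2 : h * (2 * (L + 1)) ≤ 1 :=
    (le_div_iff₀ (by positivity)).1 (hle.trans (min_le_right _ _))
  have hx₀ : x₀ ∈ Metric.closedBall x₀ ρ := Metric.mem_closedBall_self hρ.le
  have hmaps : Set.MapsTo (fun x => x₀ + h • f x) (Metric.closedBall x₀ ρ)
      (Metric.closedBall x₀ ρ) := by
    intro x hx
    have h3 := hf.dist_le_mul x (hball hx) x₀ (hball hx₀)
    rw [Metric.mem_closedBall] at hx
    rw [dist_eq_norm] at h3
    have h4 : ‖f x‖ ≤ ‖f x₀‖ + ‖f x - f x₀‖ := norm_le_norm_add_norm_sub' _ _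
    have h5 : (L : ℝ) * dist x x₀ ≤ L * ρ := mul_le_mul_of_nonneg_left hx L.2
    have h6 : ‖f x‖ ≤ N := by linarith
    rw [Metric.mem_closedBall, dist_eq_norm, add_sub_cancel_left, norm_smul,
      Real.norm_of_nonneg hh.le]
    exact (mul_le_mul_of_nonneg_left h6 hh.le).trans h1
  have hcontr : ContractingWith (1 / 2 : NNReal) (hmaps.restrict _ _ _) := by
    refine ⟨by norm_num, LipschitzWith.of_dist_le_mul fun x y => ?_⟩
    have h3 := hf.dist_le_mul x (hball x.2) y (hball y.2)
    rw [Subtype.dist_eq, Subtype.dist_eq, Set.MapsTo.val_restrict_apply,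
      Set.MapsTo.val_restrict_apply, dist_add_left, dist_smul₀, Real.norm_of_nonneg hh.le]
    have h4 : h * L ≤ 1 / 2 := by nlinarith [L.2]
    calc h * dist (f x) (f y) ≤ h * (L * dist (x : X) y) := mul_le_mul_of_nonneg_left h3 hh.le
      _ = h * L * dist (x : X) y := by ring
      _ ≤ 1 / 2 * dist (x : X) y := mul_le_mul_of_nonneg_right h4 dist_nonneg
      _ = _ := by simp
  obtain ⟨x, hx, hfix, -⟩ := hcontr.exists_fixedPoint' Metric.isClosed_closedBall.isComplete hmaps
    hx₀ (edist_ne_top _ _)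
  exact ⟨x, hball hx, hfix.symm⟩

/-! ### Solving for the stages -/

section Stages

variable {m : ℕ}

local notation "𝔼" => EuclideanSpace ℝ (Fin m)

/-- Extension by zero of a family of stages to all of `ℝ`. -/
noncomputable def extendStages (k : ℕ) (U : gaussNodes k → 𝔼) (c : ℝ) : 𝔼 :=
  if hc : c ∈ gaussNodes k then U ⟨c, hc⟩ else 0

theorem extendStages_of_mem {k : ℕ} (U : gaussNodes k → 𝔼) {c : ℝ} (hc : c ∈ gaussNodes k) :
    extendStages k U c = U ⟨c, hc⟩ := dif_pos hc

theorem contDiffOn_comp_extendStages {W : Type*} [NormedAddCommGroup W] [NormedSpace ℝ W]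
    {F : 𝔼 → W} {D : Set 𝔼} {n : ℕ} (hF : ContDiffOn ℝ n F D) {k : ℕ} {c : ℝ}
    (hc : c ∈ gaussNodes k) :
    ContDiffOn ℝ n (fun U : gaussNodes k → 𝔼 => F (extendStages k U c))
      (Set.univ.pi fun _ => D) := by
  simp only [extendStages_of_mem _ hc]
  exact hF.comp (contDiff_apply ℝ 𝔼 (⟨c, hc⟩ : gaussNodes k)).contDiffOn
    fun U hU => hU _ (Set.mem_univ _)

theorem contDiffOn_stageCoeff {H : 𝔼 → ℝ} {B : 𝔼 → Matrix (Fin m) (Fin m) ℝ} {D : Set 𝔼} {n : ℕ}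
    (hH : ContDiffOn ℝ n (gradient H) D) (hB : ∀ p q, ContDiffOn ℝ n (fun y => B y p q) D)
    (k s i : ℕ) :
    ContDiffOn ℝ n (fun U : gaussNodes k → 𝔼 => stageCoeff k s B H (extendStages k U) i)
      (Set.univ.pi fun _ => D) := by
  unfold stageCoeff
  refine ContDiffOn.sum fun j _ => ?_
  simp only [toEuclideanLin_rhoHat, gammaHat_eq]
  refine ContDiffOn.clm_apply (ContDiffOn.sum fun c hc => ?_) (ContDiffOn.sum fun c hc => ?_)
  · exact (contDiffOn_comp_extendStages (contDiffOn_toEuclideanCLM hB) hc).const_smul _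
  · exact (contDiffOn_comp_extendStages hH hc).const_smul _

/-- The increments of the curve, divided by the step. -/
theorem exists_increment_bound {H : 𝔼 → ℝ} {B : 𝔼 → Matrix (Fin m) (Fin m) ℝ} {D K : Set 𝔼}
    (hH : ContinuousOn (gradient H) D) (hB : ∀ p q, ContinuousOn (fun y => B y p q) D)
    (hK : IsCompact K) (hKD : K ⊆ D) (k s : ℕ) :
    ∃ A : ℝ, 0 ≤ A ∧ ∀ U : ℝ → 𝔼, (∀ c ∈ gaussNodes k, U c ∈ K) → ∀ x ∈ Set.Icc (0 : ℝ) 1,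
      ‖∑ i ∈ Finset.range s,
        (antiderivative (legendre i)).eval x • stageCoeff k s B H U i‖ ≤ A := by
  -- The coefficients depend continuously on the stages alone, and these range over a compact
  -- product of copies of K.
  have hcomp : IsCompact (Set.univ.pi fun _ : gaussNodes k => K) := isCompact_univ_pi fun _ => hK
  have hcoeff : ∀ i, ∃ A : ℝ, ∀ U ∈ Set.univ.pi fun _ : gaussNodes k => K,
      ‖stageCoeff k s B H (extendStages k U) i‖ ≤ A := fun i =>
    hcomp.exists_bound_of_continuousOn ((contDiffOn_stageCoeff (n := 0)
      (by simpa using hH) (by simpa using hB) k s i).continuousOn.mono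
      (Set.pi_mono fun _ _ => hKD))
  choose A hA using hcoeff
  choose Q hQ0 hQ using fun i => exists_eval_bound (antiderivative (legendre i))
  refine ⟨∑ i ∈ Finset.range s, Q i * |A i|,
    Finset.sum_nonneg fun i _ => mul_nonneg (hQ0 i) (abs_nonneg _), fun U hU x hx => ?_⟩
  refine norm_sum_le_of_le _ fun i _ => ?_
  have e : stageCoeff k s B H U = stageCoeff k s B H (extendStages k fun c => U c) :=
    stageCoeff_congr fun c hc => (extendStages_of_mem (fun c => U c) hc).symm
  rw [norm_smul, Real.norm_eq_abs, e]
  exact mul_le_mul (hQ i x hx) ((hA i _ fun c _ => hU c c.2).trans (le_abs_self _))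
    (norm_nonneg _) (hQ0 i)

/-- The unknowns are the k stages. They solve U = y₀ + h Ψ(U) with Ψ of class C¹, hence Lipschitz
near the constant family y₀; the solved stages then define the whole curve. -/
theorem exists_isPath {H : 𝔼 → ℝ} {B : 𝔼 → Matrix (Fin m) (Fin m) ℝ} {D K : Set 𝔼}
    (hH : ContDiffOn ℝ 1 (gradient H) D) (hB : ∀ p q, ContDiffOn ℝ 1 (fun y => B y p q) D)
    (hKD : K ⊆ D) (k s : ℕ) {y₀ : 𝔼} (hy₀ : K ∈ nhds y₀) :
    ∃ h₀ > (0 : ℝ), ∀ h : ℝ, 0 < h → h ≤ h₀ → ∃ u : ℝ → 𝔼, IsPath k s B H h y₀ u ∧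
      ∀ c ∈ gaussNodes k, u (c * h) ∈ K := by
  set Ψ : (gaussNodes k → 𝔼) → gaussNodes k → 𝔼 := fun U c => ∑ i ∈ Finset.range s,
    (antiderivative (legendre i)).eval (c : ℝ) • stageCoeff k s B H (extendStages k U) i with hΨ
  have hcd : ContDiffOn ℝ (1 : ℕ) Ψ (Set.univ.pi fun _ => D) :=
    contDiffOn_pi.2 fun c => ContDiffOn.sum fun i _ =>
      (contDiffOn_stageCoeff (n := 1) (by simpa using hH) (by simpa using hB) k s i).const_smul _
  have hKn : (Set.univ.pi fun _ : gaussNodes k => K) ∈ nhds (fun _ : gaussNodes k => y₀) :=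
    set_pi_mem_nhds Set.finite_univ fun _ _ => hy₀
  rw [Nat.cast_one] at hcd
  obtain ⟨L, t, ht, hL⟩ := (hcd.contDiffAt
    (Filter.mem_of_superset hKn (Set.pi_mono fun _ _ => hKD))).exists_lipschitzOnWith
  obtain ⟨h₀, hh₀, hfix⟩ := exists_fixed_of_lipschitzOnWith (Filter.inter_mem ht hKn)
    (hL.mono Set.inter_subset_left)
  refine ⟨h₀, hh₀, fun h hh hle => ?_⟩
  obtain ⟨U, ⟨-, hUK⟩, hU⟩ := hfix h hh hle
  set a := stageCoeff k s B H (extendStages k U)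
  have hval : ∀ c, polyCurve s h y₀ a (c * h / h) = polyCurve s h y₀ a c := fun c => by
    rw [mul_div_cancel_right₀ _ hh.ne']
  have hnode : ∀ c, (hc : c ∈ gaussNodes k) → polyCurve s h y₀ a c = U ⟨c, hc⟩ := fun c hc =>
    (congrFun hU ⟨c, hc⟩).symm
  refine ⟨fun τ => polyCurve s h y₀ a (τ / h), isPath_iff.2 fun c _ => ?_, fun c hc => ?_⟩
  · simp only [hval]
    rw [stageCoeff_congr (V := extendStages k U) fun c hc => by
      rw [hnode c hc, extendStages_of_mem _ hc]]
  · simp only [hval, hnode c hc]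
    exact hUK _ (Set.mem_univ _)

end Stages

end PHBVM

theorem mainTheorem4 (m k s : ℕ) (hs : 1 ≤ s) (hsk : s ≤ k)
    (D : Set (EuclideanSpace ℝ (Fin m))) (hD : IsOpen D)
    (H : EuclideanSpace ℝ (Fin m) → ℝ) (hH : ContDiffOn ℝ (2 * k + 1 : ℕ) H D)
    (B : EuclideanSpace ℝ (Fin m) → Matrix (Fin m) (Fin m) ℝ)
    (hB : ∀ p q, ContDiffOn ℝ (2 * k : ℕ) (fun y => B y p q) D)
    (hskew : ∀ y ∈ D, (B y).transpose = -B y)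
    (y₀ : EuclideanSpace ℝ (Fin m))
    (K : Set (EuclideanSpace ℝ (Fin m))) (hK : IsCompact K) (hKD : K ⊆ D)
    (hy₀ : y₀ ∈ interior K) :
    ∃ h₀ > (0 : ℝ), ∃ C : ℝ, ∀ h : ℝ, 0 < h → h ≤ h₀ →
      (∃ u : ℝ → EuclideanSpace ℝ (Fin m), PHBVM.IsPath k s B H h y₀ u ∧
        ∀ c ∈ PHBVM.gaussNodes k, u (c * h) ∈ K) ∧
      ∀ u : ℝ → EuclideanSpace ℝ (Fin m), PHBVM.IsPath k s B H h y₀ u →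
        (∀ c ∈ PHBVM.gaussNodes k, u (c * h) ∈ K) →
        u h ∈ D ∧ |H (u h) - H y₀| ≤ C * h ^ (2 * k + 1) := by
  have hKn := mem_interior_iff_mem_nhds.1 hy₀
  have hg := PHBVM.contDiffOn_gradient hD hH
  have h1k : (1 : WithTop ℕ∞) ≤ (2 * k : ℕ) := by exact_mod_cast (by omega : 1 ≤ 2 * k)
  obtain ⟨h₁, hh₁, hex⟩ := PHBVM.exists_isPath (hg.of_le h1k) (fun p q => (hB p q).of_le h1k) hKD
    k s hKn
  obtain ⟨A, hA, hinc⟩ := PHBVM.exists_increment_bound hg.continuousOn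
    (fun p q => (hB p q).continuousOn) hK hKD k s
  obtain ⟨C, hC⟩ := PHBVM.exists_energy_bound hD hsk hH hB hskew hK hKD y₀
  obtain ⟨ρ, hρ, hball⟩ := Metric.nhds_basis_closedBall.mem_iff.1 hKn
  -- The three entries serve existence, the comparison of powers of h, and confinement: only the
  -- stages are assumed to lie in K, and the last entry keeps the entire curve in a ball inside K.
  refine ⟨min h₁ (min 1 (ρ / (A + 1))), by positivity, C, fun h hh hle =>
    ⟨hex h hh (hle.trans (min_le_left _ _)), fun u hu huK => ?_⟩⟩
  have hle1 : h ≤ 1 := hle.trans ((min_le_right _ _).trans (min_le_left _ _))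
  have hleρ : h * (A + 1) ≤ ρ :=
    (le_div_iff₀ (by positivity)).1 (hle.trans ((min_le_right _ _).trans (min_le_right _ _)))
  rw [PHBVM.isPath_iff] at hu
  set v := PHBVM.polyCurve s h y₀ (PHBVM.stageCoeff k s B H fun c => u (c * h)) with hvdef
  -- The coefficients see only the nodes, where u(ch) and v(c) agree, so v satisfies the fixed-point
  -- equation on all of ℝ even though u is unconstrained off [0, h].
  have hv : v = PHBVM.polyCurve s h y₀ (PHBVM.stageCoeff k s B H v) := by
    rw [← PHBVM.stageCoeff_congr fun c hc => hu c (PHBVM.mem_Icc_of_mem_gaussNodes hc)]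
  have hvK : Set.MapsTo v (Set.Icc 0 1) K := by
    intro x hx
    apply hball
    rw [Metric.mem_closedBall, dist_eq_norm, hvdef, PHBVM.polyCurve, add_sub_cancel_left,
      norm_smul, Real.norm_of_nonneg hh.le]
    have := mul_le_mul_of_nonneg_left (hinc _ huK x hx) hh.le
    linarith
  have h1 : u h = v 1 := by
    have := hu 1 (by simp)
    rwa [one_mul] at this
  rw [h1]
  exact ⟨hKD (hvK (by simp)), hC h hh.le hle1 v hv hvK⟩
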